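/- Let $V$ be a 4-dimensional real vector space with a Lorentzian metric $g_{ab}$ of signature $(+,-,-,-)$ (for instance the tangent space at a point of a 4-dimensional Lorentzian manifold); indices are raised and lowered with $g$. For a 2-form $F_{ab}=F_{[ab]}$ on $V$ let $$T_{ab}\{F\} = -F_{ac}F_b{}^c + \tfrac14\,(F_{cd}F^{cd})\,g_{ab}$$ be its Maxwell energy-momentum tensor, and for a rank-2 tensor $T_{ab}$ put $(T\times T)_{ab}=T_{ac}T_b{}^c$. Then a tensor $T_{ab}$ on $V$ is, up to sign, the Maxwell energy-momentum tensor of a 2-form, that is, $T_{ab}=T_{ab}\{F\}$ or $T_{ab}=-T_{ab}\{F\}$ for some 2-form $F_{ab}$, if and only if $T_{ab}$ is symmetric, $(T\times T)_{ab}=f\,g_{ab}$ for some $f\in\mathbb{R}$, and $T_a{}^a=0$. -/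

import Mathlib

/-- A Lorentzian metric `g_ab` on a finite-dimensional real vector space (the tangent space at a
point of a Lorentzian manifold): a bilinear form with signature `(+, -, …, -)`, that is, one which
admits an orthonormal basis `e_0, …, e_n` with `g(e_0, e_0) = 1` and `g(e_i, e_i) = -1` for
`i ≥ 1`. -/
structure LorentzianMetric (V : Type*) [AddCommGroup V] [Module ℝ V] where
  form : LinearMap.BilinForm ℝ V
  exists_orthonormal_basis : ∃ (n : ℕ) (e : Module.Basis (Fin (n + 1)) ℝ V), ∀ i j,
    form (e i) (e j) = if i = j then (if i = 0 then 1 else -1) else 0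

namespace LorentzianMetric

variable {V : Type*} [AddCommGroup V] [Module ℝ V]

theorem form_nondegenerate (g : LorentzianMetric V) : g.form.Nondegenerate := by
  obtain ⟨n, e, he⟩ := g.exists_orthonormal_basis
  have hO : g.form.IsOrthoᵢ e := by
    intro i j hij
    show g.form (e i) (e j) = 0
    rw [he, if_neg hij]
  refine hO.nondegenerate_of_not_isOrtho_basis_self e ?_
  intro i hi
  have h : g.form (e i) (e i) = 0 := hi
  rw [he, if_pos rfl] at h
  split_ifs at h <;> norm_num at h

variable [FiniteDimensional ℝ V]

/-- Raising the second index: `T_a{}^b`, as the endomorphism `u ↦ u^a T_a{}^b`, which is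
characterised by `g (raise T u) v = T u v`. -/
noncomputable def raise (g : LorentzianMetric V) (T : LinearMap.BilinForm ℝ V) : V →ₗ[ℝ] V :=
  (g.form.toDual g.form_nondegenerate).symm.toLinearMap ∘ₗ T

theorem form_raise (g : LorentzianMetric V) (T : LinearMap.BilinForm ℝ V) (u v : V) :
    g.form (g.raise T u) v = T u v := by
  simp [raise]

/-- The trace `T_a{}^a`. -/
noncomputable def trace (g : LorentzianMetric V) (T : LinearMap.BilinForm ℝ V) : ℝ :=
  LinearMap.trace ℝ V (g.raise T)

/-- The contracted product `(S × T)_ab = S_ac T_b{}^c`. -/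
noncomputable def cross (g : LorentzianMetric V) (S T : LinearMap.BilinForm ℝ V) :
    LinearMap.BilinForm ℝ V :=
  S.compl₂ (g.raise T)

/-- The full contraction `S · T = S_ab T^ab = g^ab S_ac T_b{}^c`. -/
noncomputable def dot (g : LorentzianMetric V) (S T : LinearMap.BilinForm ℝ V) : ℝ :=
  g.trace (g.cross S T)

/-- The energy-momentum tensor of a Maxwell field `F`, in signature `(+, -, …, -)`:
`T_ab{F} = - F_ac F_b{}^c + (1/4) (F · F) g_ab`. -/
noncomputable def maxwellTensor (g : LorentzianMetric V) (F : LinearMap.BilinForm ℝ V) :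
    LinearMap.BilinForm ℝ V :=
  -g.cross F F + ((1 / 4 : ℝ) * g.dot F F) • g.form

end LorentzianMetric

/-! Necessity is an algebraic identity in the six tetrad components of `F`. For sufficiency, rotate
the spatial frame to diagonalise the stresses `t_i`. With energy density `ρ` and momentum `s_i`, the
off-diagonal part of `T × T = f g` reads `s_i s_j = 0` and `s_i (ρ - t_i) = 0`. Together with the
diagonal part and the trace condition, this leaves one axis carrying all the momentum, with stress
`ρ`; the other two stresses are `t` and `-t`, and `ρ² = s² + t²`. If `ρ ≥ 0`, perpendicular electric
and magnetic fields of suitable sizes produce this tensor; otherwise they produce `-T`. -/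

namespace LorentzianMetric

variable {V : Type*} [AddCommGroup V] [Module ℝ V]

/-- `e` is an orthonormal tetrad for `g`, with `e 0` timelike. -/
def IsTetrad (g : LorentzianMetric V) (e : Module.Basis (Fin 4) ℝ V) : Prop :=
  ∀ i j, g.form (e i) (e j) = if i = j then (if i = 0 then 1 else -1) else 0

theorem exists_isTetrad (g : LorentzianMetric V) (hV : Module.finrank ℝ V = 4) :
    ∃ e : Module.Basis (Fin 4) ℝ V, g.IsTetrad e := by
  obtain ⟨n, e, he⟩ := g.exists_orthonormal_basis
  have hn : n = 3 := by
    have h := Module.finrank_eq_card_basis e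
    rw [hV, Fintype.card_fin] at h
    omega
  subst hn
  exact ⟨e, he⟩

theorem IsTetrad.swap {g : LorentzianMetric V} {e : Module.Basis (Fin 4) ℝ V}
    (he : g.IsTetrad e) {i j : Fin 4} (hi : i ≠ 0) (hj : j ≠ 0) :
    g.IsTetrad (e.reindex (Equiv.swap i j)) := by
  intro k l
  have h0 : Equiv.swap i j k = 0 ↔ k = 0 := by
    rw [Equiv.swap_apply_eq_iff, Equiv.swap_apply_of_ne_of_ne hi.symm hj.symm]
  simp only [Module.Basis.reindex_apply, Equiv.symm_swap, he _ _, h0, EmbeddingLike.apply_eq_iff_eq]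

/-- The 2-form with electric field `a` along `e 2` and magnetic field `b` along `e 3`. -/
noncomputable def crossedField (e : Module.Basis (Fin 4) ℝ V) (a b : ℝ) :
    LinearMap.BilinForm ℝ V :=
  Matrix.toBilin e !![0, 0, a, 0; 0, 0, b, 0; -a, -b, 0, 0; 0, 0, 0, 0]

theorem crossedField_apply (e : Module.Basis (Fin 4) ℝ V) (a b : ℝ) (i j : Fin 4) :
    crossedField e a b (e i) (e j) =
      !![0, 0, a, 0; 0, 0, b, 0; -a, -b, 0, 0; 0, 0, 0, 0] i j := by
  rw [crossedField, ← LinearMap.BilinForm.toMatrix_apply, LinearMap.BilinForm.toMatrix_toBilin]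

theorem crossedField_isAlt (e : Module.Basis (Fin 4) ℝ V) (a b : ℝ) :
    (crossedField e a b).IsAlt := by
  intro u
  rw [crossedField, Matrix.toBilin_apply]
  simp [Fin.sum_univ_four]
  ring

/-- Every symmetric form has a tetrad in which its spatial block is diagonal. -/
theorem exists_isTetrad_spatial_diagonal (g : LorentzianMetric V) (hV : Module.finrank ℝ V = 4)
    {T : LinearMap.BilinForm ℝ V} (hT : T.IsSymm) :
    ∃ e : Module.Basis (Fin 4) ℝ V, g.IsTetrad e ∧
      ∀ i j : Fin 3, i ≠ j → T (e i.succ) (e j.succ) = 0 := by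
  obtain ⟨e, he⟩ := g.exists_isTetrad hV
  set M : Matrix (Fin 3) (Fin 3) ℝ := Matrix.of fun i j => T (e i.succ) (e j.succ) with hMdef
  have hM : M.IsHermitian := by
    ext i j
    simp [hMdef, hT.eq]
  -- On the spatial span `g` is minus the Euclidean product, so Euclidean-orthonormal eigenvectors
  -- again complete `e 0` to a tetrad.
  let b := hM.eigenvectorBasis
  let w (i : Fin 3) : V := ∑ k, b i k • e k.succ
  have hb (i j : Fin 3) : ∑ k, b i k * b j k = if i = j then 1 else 0 := by
    have h := orthonormal_iff_ite.1 b.orthonormal i j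
    simpa [PiLp.inner_apply, mul_comm] using h
  have hww (S : LinearMap.BilinForm ℝ V) (i j : Fin 3) :
      S (w i) (w j) = ∑ k, b i k * ∑ l, S (e k.succ) (e l.succ) * b j l := by
    simp only [w, map_sum, LinearMap.sum_apply, map_smul, LinearMap.smul_apply, smul_eq_mul,
      Finset.mul_sum]
    rw [Finset.sum_comm]
    exact Finset.sum_congr rfl fun k _ => Finset.sum_congr rfl fun l _ => by ring
  let v : Fin 4 → V := Fin.cons (e 0) w
  have h0w (i : Fin 3) : g.form (e 0) (w i) = 0 := by
    simp [w, he _ _, (Fin.succ_ne_zero _).symm]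
  have hw0 (i : Fin 3) : g.form (w i) (e 0) = 0 := by
    simp [w, he _ _]
  have hv (i j : Fin 4) :
      g.form (v i) (v j) = if i = j then (if i = 0 then 1 else -1) else 0 := by
    refine Fin.cases ?_ (fun i => ?_) i <;> refine Fin.cases ?_ (fun j => ?_) j
    · simp [v, he _ _]
    · simp [v, h0w, (Fin.succ_ne_zero _).symm]
    · simp [v, hw0]
    · have := hb i j
      simp only [v, Fin.cons_succ, hww, he _ _, Fin.succ_inj, Fin.succ_ne_zero, if_false,
        ite_mul, zero_mul, Finset.sum_ite_eq, Finset.mem_univ, if_true, neg_one_mul, mul_neg,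
        Finset.sum_neg_distrib, this]
      split_ifs <;> simp
  have hli : LinearIndependent ℝ v := by
    refine LinearMap.BilinForm.linearIndependent_of_iIsOrtho (B := g.form) (v := v)
      (fun i j hij => ?_) fun i hi => ?_
    · change g.form _ _ = 0
      rw [hv, if_neg hij]
    · have h : g.form (v i) (v i) = 0 := hi
      rw [hv, if_pos rfl] at h
      split_ifs at h <;> norm_num at h
  refine ⟨basisOfLinearIndependentOfCardEqFinrank hli (by rw [hV, Fintype.card_fin]), ?_, ?_⟩
  · intro i j
    rw [coe_basisOfLinearIndependentOfCardEqFinrank, hv]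
  · intro i j hij
    rw [coe_basisOfLinearIndependentOfCardEqFinrank]
    have hev (k : Fin 3) : ∑ l, T (e k.succ) (e l.succ) * b j l = hM.eigenvalues j * b j k := by
      have := congrFun (hM.mulVec_eigenvectorBasis j) k
      simpa [Matrix.mulVec, dotProduct, hMdef] using this
    simp only [v, Fin.cons_succ, hww, hev, mul_left_comm (b i _), ← Finset.mul_sum, hb,
      if_neg hij, mul_zero]

variable [FiniteDimensional ℝ V]

section Coordinates

variable {g : LorentzianMetric V} {e : Module.Basis (Fin 4) ℝ V}

theorem IsTetrad.raise_eq (he : g.IsTetrad e) (T : LinearMap.BilinForm ℝ V) (u : V) :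
    g.raise T u = ∑ k, ((if k = 0 then 1 else -1) * T u (e k)) • e k := by
  refine (g.form.toDual g.form_nondegenerate).injective (e.ext fun j => ?_)
  change g.form _ _ = g.form _ _
  rw [form_raise, map_sum, LinearMap.sum_apply]
  simp only [map_smul, LinearMap.smul_apply, he _ _, smul_eq_mul]
  rw [Finset.sum_eq_single j (fun k _ hk => by simp [hk]) (by simp)]
  rw [if_pos rfl]
  split_ifs <;> simp

theorem IsTetrad.cross_apply (he : g.IsTetrad e) (S T : LinearMap.BilinForm ℝ V) (u v : V) :
    g.cross S T u v = ∑ k, (if k = 0 then 1 else -1) * (S u (e k) * T v (e k)) := by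
  rw [cross, LinearMap.compl₂_apply, he.raise_eq, map_sum]
  refine Finset.sum_congr rfl fun k _ => ?_
  rw [map_smul, smul_eq_mul]
  ring

theorem IsTetrad.trace_eq (he : g.IsTetrad e) (T : LinearMap.BilinForm ℝ V) :
    g.trace T = ∑ k, (if k = 0 then 1 else -1) * T (e k) (e k) := by
  rw [trace, LinearMap.trace_eq_matrix_trace ℝ e, Matrix.trace]
  refine Finset.sum_congr rfl fun k _ => ?_
  rw [Matrix.diag_apply, LinearMap.toMatrix_apply, he.raise_eq, e.repr_sum_self]

theorem IsTetrad.maxwellTensor_apply (he : g.IsTetrad e) (F : LinearMap.BilinForm ℝ V)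
    (i j : Fin 4) :
    g.maxwellTensor F (e i) (e j) =
      -(∑ k, (if k = 0 then 1 else -1) * (F (e i) (e k) * F (e j) (e k))) +
      (1 / 4) * (∑ l, (if l = 0 then 1 else -1) *
        ∑ k, (if k = 0 then 1 else -1) * (F (e l) (e k) * F (e l) (e k))) *
      (if i = j then (if i = 0 then 1 else -1) else 0) := by
  simp only [maxwellTensor, dot, LinearMap.add_apply, LinearMap.neg_apply, LinearMap.smul_apply,
    he.cross_apply, he.trace_eq, he i j, smul_eq_mul]

end Coordinates

/-! ### Necessity: algebraic identities of the Maxwell tensor -/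

theorem maxwellTensor_isSymm (g : LorentzianMetric V) (hV : Module.finrank ℝ V = 4)
    (F : LinearMap.BilinForm ℝ V) : (g.maxwellTensor F).IsSymm := by
  obtain ⟨e, he⟩ := g.exists_isTetrad hV
  refine (LinearMap.BilinForm.isSymm_iff_basis e).2 fun i j => ?_
  simp only [he.maxwellTensor_apply]
  congr 1
  · simp only [mul_comm]
  · congr 1
    by_cases h : i = j
    · subst h; rfl
    · rw [if_neg h, if_neg (Ne.symm h)]

/-- Dimension four matters: `g` has trace 4, which cancels the factor `1/4`. -/
theorem trace_maxwellTensor (g : LorentzianMetric V) (hV : Module.finrank ℝ V = 4)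
    (F : LinearMap.BilinForm ℝ V) : g.trace (g.maxwellTensor F) = 0 := by
  obtain ⟨e, he⟩ := g.exists_isTetrad hV
  simp only [he.trace_eq, he.maxwellTensor_apply, Fin.sum_univ_four]
  simp
  ring

theorem cross_maxwellTensor_self (g : LorentzianMetric V) (hV : Module.finrank ℝ V = 4)
    {F : LinearMap.BilinForm ℝ V} (hF : F.IsAlt) :
    ∃ f : ℝ, g.cross (g.maxwellTensor F) (g.maxwellTensor F) = f • g.form := by
  obtain ⟨e, he⟩ := g.exists_isTetrad hV
  have hd (i : Fin 4) : F (e i) (e i) = 0 := hF _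
  have hn (i j : Fin 4) : F (e i) (e j) = -F (e j) (e i) := (hF.neg_eq _ _).symm
  -- Since `g(e 0, e 0) = 1`, `f` must be the 00 component.
  refine ⟨g.cross (g.maxwellTensor F) (g.maxwellTensor F) (e 0) (e 0),
    LinearMap.BilinForm.ext_basis e fun i j => ?_⟩
  simp only [LinearMap.smul_apply, he.cross_apply, he.maxwellTensor_apply, he i j,
    Fin.sum_univ_four, hd, hn 1 0, hn 2 0, hn 3 0, hn 2 1, hn 3 1, hn 3 2, smul_eq_mul]
  fin_cases i <;> fin_cases j <;>
    simp [hd, hn 1 0, hn 2 0, hn 3 0, hn 2 1, hn 3 1, hn 3 2] <;> ring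

/-! ### Sufficiency: normal form and reconstruction of the field -/

/-- A symmetric form which in a tetrad is block diagonal with a boost block `(ρ, s; s, ρ)` and a
spatial block `diag (t, -t)` satisfying `ρ² = s² + t²` and `0 ≤ ρ` is a Maxwell tensor. -/
theorem IsTetrad.exists_maxwellTensor_of_nonneg {g : LorentzianMetric V}
    {e : Module.Basis (Fin 4) ℝ V} (he : g.IsTetrad e) {T : LinearMap.BilinForm ℝ V} {ρ s t : ℝ}
    (hT : ∀ i j, T (e i) (e j) = !![ρ, s, 0, 0; s, ρ, 0, 0; 0, 0, t, 0; 0, 0, 0, -t] i j)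
    (hρ : 0 ≤ ρ) (h : ρ ^ 2 = s ^ 2 + t ^ 2) :
    ∃ F : LinearMap.BilinForm ℝ V, F.IsAlt ∧ T = g.maxwellTensor F := by
  have ht := abs_le.1 (abs_le_of_sq_le_sq (a := t) (b := ρ) (by nlinarith [sq_nonneg s]) hρ)
  -- The crossed field has `ρ = (a² + b²)/2`, `t = (b² - a²)/2` and `s = ab`; the bound `|t| ≤ ρ`
  -- makes both roots real, and the sign of `b` is fitted to `s`.
  obtain ⟨a, b, ha, hb, hab⟩ : ∃ a b : ℝ, a ^ 2 = ρ - t ∧ b ^ 2 = ρ + t ∧ a * b = s := by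
    have h1 : √(ρ - t) ^ 2 = ρ - t := Real.sq_sqrt (by linarith)
    have h2 : √(ρ + t) ^ 2 = ρ + t := Real.sq_sqrt (by linarith)
    have h3 : (√(ρ - t) * √(ρ + t)) ^ 2 = s ^ 2 := by
      rw [mul_pow, h1, h2]; linarith
    rcases sq_eq_sq_iff_eq_or_eq_neg.1 h3 with h4 | h4
    · exact ⟨_, _, h1, h2, h4⟩
    · exact ⟨_, -√(ρ + t), h1, by rw [neg_sq, h2], by rw [mul_neg, h4, neg_neg]⟩
  refine ⟨crossedField e a b, crossedField_isAlt e a b,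
    LinearMap.BilinForm.ext_basis e fun i j => ?_⟩
  rw [hT, he.maxwellTensor_apply]
  simp only [crossedField_apply, Fin.sum_univ_four]
  fin_cases i <;> fin_cases j <;> simp <;> linarith

theorem IsTetrad.exists_maxwellTensor {g : LorentzianMetric V}
    {e : Module.Basis (Fin 4) ℝ V} (he : g.IsTetrad e) {T : LinearMap.BilinForm ℝ V} {ρ s t : ℝ}
    (hT : ∀ i j, T (e i) (e j) = !![ρ, s, 0, 0; s, ρ, 0, 0; 0, 0, t, 0; 0, 0, 0, -t] i j)
    (h : ρ ^ 2 = s ^ 2 + t ^ 2) :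
    ∃ F : LinearMap.BilinForm ℝ V, F.IsAlt ∧
      (T = g.maxwellTensor F ∨ T = -g.maxwellTensor F) := by
  rcases le_total 0 ρ with hρ | hρ
  · obtain ⟨F, hF, h1⟩ := he.exists_maxwellTensor_of_nonneg hT hρ h
    exact ⟨F, hF, Or.inl h1⟩
  · obtain ⟨F, hF, h1⟩ := he.exists_maxwellTensor_of_nonneg (T := -T) (ρ := -ρ) (s := -s)
      (t := -t) (fun i j => by
        rw [LinearMap.neg_apply, LinearMap.neg_apply, hT]
        fin_cases i <;> fin_cases j <;> simp) (by linarith) (by linarith)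
    exact ⟨F, hF, Or.inr (by rw [← h1]; ext u v; simp)⟩

/-- The scalar relations satisfied by a trace-free symmetric form with `T × T = f g` and spatial
block `diag (t₁, t₂, t₃)` single out a spatial axis carrying the whole momentum density. -/
theorem exists_momentum_axis {ρ s₁ s₂ s₃ t₁ t₂ t₃ f : ℝ}
    (htr : ρ + -t₁ + -t₂ + -t₃ = 0)
    (h₀ : ρ * ρ + -(s₁ * s₁) + -(s₂ * s₂) + -(s₃ * s₃) = f)
    (h₁ : ρ * s₁ + -(s₁ * t₁) = 0) (h₂ : ρ * s₂ + -(s₂ * t₂) = 0) (h₃ : ρ * s₃ + -(s₃ * t₃) = 0)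
    (h₁₁ : s₁ * s₁ + -(t₁ * t₁) = -f) (h₂₂ : s₂ * s₂ + -(t₂ * t₂) = -f)
    (h₃₃ : s₃ * s₃ + -(t₃ * t₃) = -f)
    (h₁₂ : s₁ = 0 ∨ s₂ = 0) (h₁₃ : s₁ = 0 ∨ s₃ = 0) (h₂₃ : s₂ = 0 ∨ s₃ = 0) :
    (t₁ = ρ ∧ s₂ = 0 ∧ s₃ = 0) ∨ (t₂ = ρ ∧ s₁ = 0 ∧ s₃ = 0) ∨ (t₃ = ρ ∧ s₂ = 0 ∧ s₁ = 0) := by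
  have axis {s t : ℝ} (h : ρ * s + -(s * t) = 0) (hs : s ≠ 0) : t = ρ :=
    mul_left_cancel₀ hs (by linarith)
  by_cases hs₁ : s₁ = 0
  · by_cases hs₂ : s₂ = 0
    · by_cases hs₃ : s₃ = 0
      · subst hs₁ hs₂ hs₃
        have sign {t : ℝ} (h : 0 * 0 + -(t * t) = -f) : t = ρ ∨ t = -ρ :=
          mul_self_eq_mul_self_iff.1 (by linarith)
        rcases sign h₁₁ with h | h
        · exact Or.inl ⟨h, rfl, rfl⟩
        rcases sign h₂₂ with h' | h'
        · exact Or.inr (Or.inl ⟨h', rfl, rfl⟩)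
        rcases sign h₃₃ with h'' | h''
        · exact Or.inr (Or.inr ⟨h'', rfl, rfl⟩)
        -- If every stress is `-ρ`, the trace gives `ρ = -3ρ`, so `ρ = 0` and any axis serves.
        · exact Or.inl ⟨by linarith, rfl, rfl⟩
      · exact Or.inr (Or.inr ⟨axis h₃ hs₃, hs₂, hs₁⟩)
    · exact Or.inr (Or.inl ⟨axis h₂ hs₂, hs₁, h₂₃.resolve_left hs₂⟩)
  · exact Or.inl ⟨axis h₁ hs₁, h₁₂.resolve_left hs₁, h₁₃.resolve_left hs₁⟩

theorem exists_maxwellTensor (g : LorentzianMetric V) (hV : Module.finrank ℝ V = 4)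
    {T : LinearMap.BilinForm ℝ V} (hT : T.IsSymm) {f : ℝ} (hf : g.cross T T = f • g.form)
    (htr : g.trace T = 0) :
    ∃ F : LinearMap.BilinForm ℝ V, F.IsAlt ∧
      (T = g.maxwellTensor F ∨ T = -g.maxwellTensor F) := by
  obtain ⟨e, he, hdiag⟩ := g.exists_isTetrad_spatial_diagonal hV hT
  have hs (i j : Fin 4) : T (e i) (e j) = T (e j) (e i) := hT.eq _ _
  have h12 : T (e 1) (e 2) = 0 := hdiag 0 1 (by decide)
  have h13 : T (e 1) (e 3) = 0 := hdiag 0 2 (by decide)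
  have h23 : T (e 2) (e 3) = 0 := hdiag 1 2 (by decide)
  have h21 : T (e 2) (e 1) = 0 := hdiag 1 0 (by decide)
  have h31 : T (e 3) (e 1) = 0 := hdiag 2 0 (by decide)
  have h32 : T (e 3) (e 2) = 0 := hdiag 2 1 (by decide)
  have hc (i j : Fin 4) := LinearMap.congr_fun₂ hf (e i) (e j)
  simp only [LinearMap.smul_apply, he.cross_apply, he _ _, Fin.sum_univ_four, smul_eq_mul] at hc
  rw [he.trace_eq, Fin.sum_univ_four] at htr
  have c00 := hc 0 0
  have c01 := hc 0 1
  have c02 := hc 0 2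
  have c03 := hc 0 3
  have c11 := hc 1 1
  have c22 := hc 2 2
  have c33 := hc 3 3
  have c12 := hc 1 2
  have c13 := hc 1 3
  have c23 := hc 2 3
  simp [h12, h13, h23, h21, h31, h32, hs 1 0, hs 2 0, hs 3 0] at c00 c01 c02 c03 c11 c22 c33
  simp [h12, h13, h23, h21, h31, h32, hs 1 0, hs 2 0, hs 3 0] at c12 c13 c23 htr
  rcases exists_momentum_axis htr c00 c01 c02 c03 c11 c22 c33 c12 c13 c23 with
    ⟨h1, h2, h3⟩ | ⟨h1, h2, h3⟩ | ⟨h1, h2, h3⟩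
  · have ht : T (e 3) (e 3) = -T (e 2) (e 2) := by linarith
    refine he.exists_maxwellTensor (ρ := T (e 0) (e 0)) (s := T (e 0) (e 1))
      (t := T (e 2) (e 2)) (fun i j => ?_) ?_
    · fin_cases i <;> fin_cases j <;>
        simp [h12, h13, h23, h21, h31, h32, hs 1 0, hs 2 0, hs 3 0, h1, h2, h3, ht]
    · simp only [h2, h3] at c00 c22
      linarith
  · have ht : T (e 3) (e 3) = -T (e 1) (e 1) := by linarith
    -- Relabelling the spatial vectors moves the momentum axis to position 1.
    refine (he.swap (i := 1) (j := 2) (by decide) (by decide)).exists_maxwellTensor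
      (ρ := T (e 0) (e 0)) (s := T (e 0) (e 2)) (t := T (e 1) (e 1)) (fun i j => ?_) ?_
    · fin_cases i <;> fin_cases j <;>
        simp [Equiv.swap_apply_def,
          h12, h13, h23, h21, h31, h32, hs 1 0, hs 2 0, hs 3 0, h1, h2, h3, ht]
    · simp only [h2, h3] at c00 c11
      linarith
  · have ht : T (e 1) (e 1) = -T (e 2) (e 2) := by linarith
    refine (he.swap (i := 1) (j := 3) (by decide) (by decide)).exists_maxwellTensor
      (ρ := T (e 0) (e 0)) (s := T (e 0) (e 3)) (t := T (e 2) (e 2)) (fun i j => ?_) ?_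
    · fin_cases i <;> fin_cases j <;>
        simp [Equiv.swap_apply_def,
          h12, h13, h23, h21, h31, h32, hs 1 0, hs 2 0, hs 3 0, h1, h2, h3, ht]
    · simp only [h2, h3] at c00 c22
      linarith

end LorentzianMetric

theorem mainTheorem9 {V : Type*} [AddCommGroup V] [Module ℝ V] [FiniteDimensional ℝ V]
    (hV : Module.finrank ℝ V = 4) (g : LorentzianMetric V) (T : LinearMap.BilinForm ℝ V) :
    (∃ F : LinearMap.BilinForm ℝ V, F.IsAlt ∧
      (T = g.maxwellTensor F ∨ T = -g.maxwellTensor F)) ↔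
    T.IsSymm ∧ (∃ f : ℝ, g.cross T T = f • g.form) ∧ g.trace T = 0 := by
  constructor
  · rintro ⟨F, hF, hT⟩
    obtain ⟨f, hf⟩ := g.cross_maxwellTensor_self hV hF
    have hs := g.maxwellTensor_isSymm hV F
    have ht := g.trace_maxwellTensor hV F
    rcases hT with rfl | rfl
    · exact ⟨hs, ⟨f, hf⟩, ht⟩
    · refine ⟨hs.neg, ⟨f, ?_⟩, ?_⟩
      · rw [← hf]
        obtain ⟨e, he⟩ := g.exists_isTetrad hV
        ext u v
        simp [he.cross_apply]
      · obtain ⟨e, he⟩ := g.exists_isTetrad hV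
        rw [he.trace_eq] at ht ⊢
        simpa [← neg_add, ← Finset.sum_neg_distrib] using congrArg Neg.neg ht
  · rintro ⟨hs, ⟨f, hf⟩, ht⟩
    exact g.exists_maxwellTensor hV hs hf ht
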